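/- Let $\mathbf{t} = t_0t_1t_2\cdots = 01101001\cdots$ be the Thue–Morse word, i.e., $t_n \in \{0,1\}$ is the parity of the number of $1$'s in the binary expansion of $n$. For $n \ge 0$ let $c(n)$ denote its cyclic complexity: the number of length-$n$ factors (blocks of $n$ consecutive letters) of $\mathbf{t}$, where factors that are cyclic shifts of each other are counted only once. Then $$\liminf_{n\to\infty} \frac{c(n)}{n} = \frac{4}{3}.$$ -/

import Mathlib

/-- The Thue–Morse word `t = 01101001⋯`: the `n`-th letter (`n = 0, 1, 2, …`) is the parity of
the number of ones in the binary expansion of `n`. -/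
def thueMorse (n : ℕ) : Fin 2 :=
  Fin.ofNat 2 (Nat.digits 2 n).sum

/-- The length-`n` block `x i, x (i+1), …, x (i+n-1)` of the infinite word `x`. -/
def wordBlock {α : Type*} (x : ℕ → α) (i n : ℕ) : List α :=
  (List.range n).map fun j => x (i + j)

/-- The set of length-`n` factors of the infinite word `x`. -/
def wordFactors {α : Type*} (x : ℕ → α) (n : ℕ) : Set (List α) :=
  Set.range fun i => wordBlock x i n

/-- The length-`n` factors of `x` up to cyclic shift: `Cycle α` is the type of finite words over
`α` modulo the relation `List.IsRotated` of being cyclic shifts of each other. -/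
def cyclicFactors {α : Type*} (x : ℕ → α) (n : ℕ) : Set (Cycle α) :=
  (fun w : List α => (w : Cycle α)) '' wordFactors x n

/-- Over a finite alphabet there are finitely many factors of each length up to cyclic shift,
so that their `Set.ncard` is their actual number. -/
theorem cyclicFactors_finite {α : Type*} [Finite α] (x : ℕ → α) (n : ℕ) :
    (cyclicFactors x n).Finite := by
  refine Set.Finite.image _ ((List.finite_length_eq α n).subset ?_)
  rintro _ ⟨i, rfl⟩
  simp [wordBlock]

/-- The cyclic complexity of an infinite word `x` over a finite alphabet: the number of length-`n`
factors of `x`, where factors that agree up to cyclic shift are counted only once. -/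
noncomputable def cyclicComplexity {α : Type*} [Finite α] (x : ℕ → α) (n : ℕ) : ℕ :=
  (cyclicFactors x n).ncard

/-! ### Blocks of an infinite word -/

section Blocks

variable {α : Type*} (x : ℕ → α)

/-! Write `d(n)` and `e(n)` for the numbers of length-`n` factors with distinct and with equal end
letters, and `μ` for `thueMap`. The theorem follows from comparing `c(n)` with `d(n+1)`: always
`c(n) ≥ d(n+1) - C` and `3 d(n+1) ≥ 4n`, while along `n = 6·2^j` one has `d(n+1) = 4n/3` and `c(n)`
exceeds this by at most a constant.

Every factor is read off from `μ u` for a shorter factor `u`, up to deleting end letters. Since `μ`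
keeps the first letter and flips the last, this gives recursions for `e` and `d` under `n ↦ 2n,
2n+1`, from which `endsCount_bounds` is extracted. The absence of cubes of letters makes the parity
of the block alignment recognisable.

For even lengths, the classes of `μ u` correspond to those of `u`, and the only new classes come
from words `u` of length `n+1` with distinct ends, so `c(2n) = c(n) + d(n+1)`
(`cyclicComplexity_two_mul`). For odd lengths, each class contains at most one "terminal"
representative `μ v · b`, and exhibiting enough terminal pairs gives `d(n+1) ≤ c(n) + 4r`, where `r`
counts the right special words of some shorter length; `r` is bounded because the factor complexity
has bounded increments. -/

theorem length_wordBlock (i n : ℕ) : (wordBlock x i n).length = n := by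
  simp [wordBlock]

theorem wordBlock_succ (i n : ℕ) : wordBlock x i (n + 1) = x i :: wordBlock x (i + 1) n := by
  simp only [wordBlock, List.range_succ_eq_map, List.map_cons, List.map_map, Nat.add_zero]
  congr 1
  refine List.map_congr_left fun j _ => ?_
  simp only [Function.comp_apply]
  congr 1
  omega

theorem wordBlock_succ' (i n : ℕ) : wordBlock x i (n + 1) = wordBlock x i n ++ [x (i + n)] := by
  simp [wordBlock, List.range_succ]

theorem wordBlock_add (i m n : ℕ) :
    wordBlock x i (m + n) = wordBlock x i m ++ wordBlock x (i + m) n := by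
  induction n with
  | zero => simp [wordBlock]
  | succ n ih => rw [← Nat.add_assoc, wordBlock_succ', ih, wordBlock_succ']; simp [Nat.add_assoc]

theorem tail_wordBlock (i n : ℕ) : (wordBlock x i (n + 1)).tail = wordBlock x (i + 1) n := by
  rw [wordBlock_succ, List.tail_cons]

theorem dropLast_wordBlock (i n : ℕ) : (wordBlock x i (n + 1)).dropLast = wordBlock x i n := by
  rw [wordBlock_succ', List.dropLast_concat]

theorem wordFactors_finite [Finite α] (n : ℕ) : (wordFactors x n).Finite := by
  refine (List.finite_length_eq α n).subset ?_
  rintro _ ⟨i, rfl⟩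
  exact length_wordBlock x i n

variable {x}

theorem length_of_mem_wordFactors {n : ℕ} {w : List α} (h : w ∈ wordFactors x n) :
    w.length = n := by
  obtain ⟨i, rfl⟩ := h
  exact length_wordBlock x i n

theorem mem_wordFactors_of_append {n : ℕ} {p w s : List α} (h : p ++ w ++ s ∈ wordFactors x n) :
    w ∈ wordFactors x w.length := by
  have hl := length_of_mem_wordFactors h
  obtain ⟨i, hi⟩ := h
  simp only [List.length_append] at hl
  refine ⟨i + p.length, ?_⟩
  simp only [← hl, wordBlock_add] at hi
  have h1 := List.append_inj_left' hi (by simp [length_wordBlock])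
  exact List.append_inj_right h1 (by simp [length_wordBlock])

theorem mem_wordFactors_of_cons {n : ℕ} {a : α} {w : List α} (h : a :: w ∈ wordFactors x (n + 1)) :
    w ∈ wordFactors x n := by
  have hl := length_of_mem_wordFactors h
  have : w ∈ wordFactors x w.length :=
    mem_wordFactors_of_append (p := [a]) (s := []) (by simpa using h)
  simp only [List.length_cons] at hl
  rwa [show w.length = n by omega] at this

theorem mem_wordFactors_of_concat {n : ℕ} {a : α} {w : List α}
    (h : w ++ [a] ∈ wordFactors x (n + 1)) : w ∈ wordFactors x n := by
  have hl := length_of_mem_wordFactors h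
  have : w ∈ wordFactors x w.length :=
    mem_wordFactors_of_append (p := []) (s := [a]) (by simpa using h)
  simp only [List.length_append, List.length_singleton] at hl
  rwa [show w.length = n by omega] at this

end Blocks

/-! ### The Thue–Morse morphism -/

/-- The morphism `0 ↦ 01`, `1 ↦ 10`. -/
def thueMap : List (Fin 2) → List (Fin 2)
  | [] => []
  | a :: l => a :: (a + 1) :: thueMap l

@[simp] theorem thueMap_nil : thueMap [] = [] := rfl

@[simp] theorem thueMap_cons (a : Fin 2) (l : List (Fin 2)) :
    thueMap (a :: l) = a :: (a + 1) :: thueMap l := rfl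

@[simp] theorem thueMap_append (l l' : List (Fin 2)) :
    thueMap (l ++ l') = thueMap l ++ thueMap l' := by
  induction l with
  | nil => rfl
  | cons a l ih => simp [ih]

@[simp] theorem length_thueMap (l : List (Fin 2)) : (thueMap l).length = 2 * l.length := by
  induction l with
  | nil => rfl
  | cons a l ih => simp [ih]; omega

theorem thueMap_injective : Function.Injective thueMap := by
  intro l l' h
  induction l generalizing l' with
  | nil => cases l' with
    | nil => rfl
    | cons b l' => simp at h
  | cons a l ih => cases l' with
    | nil => simp at h
    | cons b l' =>
      simp only [thueMap_cons, List.cons.injEq] at h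
      rw [h.1, ih h.2.2]

@[simp] theorem fin_two_add_one_add_one (a : Fin 2) : a + 1 + 1 = a := by
  revert a; decide

theorem fin_two_add_one_ne (a : Fin 2) : a + 1 ≠ a := by
  revert a; decide

theorem fin_two_ne_iff {a b : Fin 2} : a ≠ b ↔ a = b + 1 := by
  revert a b; decide

theorem thueMap_eq_append {u l₁ l₂ : List (Fin 2)} (h : thueMap u = l₁ ++ l₂) :
    (∃ u₁ u₂, u = u₁ ++ u₂ ∧ l₁ = thueMap u₁ ∧ l₂ = thueMap u₂) ∨
      ∃ u₁ c u₂, u = u₁ ++ c :: u₂ ∧ l₁ = thueMap u₁ ++ [c] ∧ l₂ = (c + 1) :: thueMap u₂ := by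
  induction u generalizing l₁ with
  | nil =>
    simp only [thueMap_nil, List.nil_eq, List.append_eq_nil_iff] at h
    exact Or.inl ⟨[], [], by simp [h]⟩
  | cons a u ih =>
    match l₁, h with
    | [], h => exact Or.inl ⟨[], a :: u, by simpa using h.symm⟩
    | [b], h =>
      simp only [thueMap_cons, List.cons_append, List.nil_append, List.cons.injEq] at h
      exact Or.inr ⟨[], a, u, by simp [h.1, ← h.2]⟩
    | b :: c :: l₁, h =>
      simp only [thueMap_cons, List.cons_append, List.cons.injEq] at h
      obtain ⟨rfl, rfl, h⟩ := h
      rcases ih h with ⟨u₁, u₂, rfl, rfl, rfl⟩ | ⟨u₁, d, u₂, rfl, rfl, rfl⟩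
      · exact Or.inl ⟨a :: u₁, u₂, by simp⟩
      · exact Or.inr ⟨a :: u₁, d, u₂, by simp⟩

theorem cons_cons_mem_range_thueMap {a b : Fin 2} {l : List (Fin 2)} :
    a :: b :: l ∈ Set.range thueMap ↔ b = a + 1 ∧ l ∈ Set.range thueMap := by
  constructor
  · rintro ⟨u, hu⟩
    cases u with
    | nil => simp at hu
    | cons c u =>
      simp only [thueMap_cons, List.cons.injEq] at hu
      exact ⟨by rw [← hu.2.1, hu.1], u, hu.2.2⟩
  · rintro ⟨rfl, u, rfl⟩
    exact ⟨a :: u, rfl⟩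

/-- Synchronisation: if a word splits into blocks `01`, `10` at both alignments, adjacent letters
always differ, so it alternates and the preimage `v` is constant. Absence of cubes then excludes
long `v`. -/
theorem cons_thueMap_append_mem_range {a : Fin 2} {v r : List (Fin 2)} :
    a :: (thueMap v ++ r) ∈ Set.range thueMap ↔
      (∀ d ∈ v, d = a + 1) ∧ a :: r ∈ Set.range thueMap := by
  induction v with
  | nil => simp
  | cons d v ih =>
    simp only [thueMap_cons, List.cons_append, cons_cons_mem_range_thueMap, List.mem_cons,
      forall_eq_or_imp, and_assoc]
    refine and_congr_right ?_
    rintro rfl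
    simpa using ih

theorem cons_thueMap_concat_mem_range {a b : Fin 2} {v : List (Fin 2)} :
    a :: (thueMap v ++ [b]) ∈ Set.range thueMap ↔ (∀ d ∈ v, d = a + 1) ∧ b = a + 1 := by
  rw [cons_thueMap_append_mem_range, cons_cons_mem_range_thueMap]
  exact and_congr_right fun _ => and_iff_left ⟨[], rfl⟩

/-! ### Factors of the Thue–Morse word -/

theorem thueMorse_two_mul (n : ℕ) : thueMorse (2 * n) = thueMorse n := by
  rcases Nat.eq_zero_or_pos n with rfl | hn
  · rfl
  · rw [thueMorse, Nat.digits_def' (by norm_num) (by omega)]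
    simp [thueMorse]

theorem thueMorse_two_mul_add_one (n : ℕ) : thueMorse (2 * n + 1) = thueMorse n + 1 := by
  rw [thueMorse, Nat.digits_def' (by norm_num) (by omega)]
  have h1 : (2 * n + 1) % 2 = 1 := by omega
  have h2 : (2 * n + 1) / 2 = n := by omega
  rw [h1, h2, List.sum_cons, thueMorse]
  ext
  simp [Fin.ofNat, Fin.val_add, Nat.add_comm]

theorem thueMap_wordBlock (i n : ℕ) :
    thueMap (wordBlock thueMorse i n) = wordBlock thueMorse (2 * i) (2 * n) := by
  induction n generalizing i with
  | zero => rfl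
  | succ n ih =>
    rw [wordBlock_succ, thueMap_cons, ih, show 2 * (n + 1) = 2 * n + 1 + 1 by ring, wordBlock_succ,
      wordBlock_succ, thueMorse_two_mul, thueMorse_two_mul_add_one]
    rfl

theorem thueMorse_no_cube (i : ℕ) :
    ¬ (thueMorse i = thueMorse (i + 1) ∧ thueMorse (i + 1) = thueMorse (i + 2)) := by
  rintro ⟨h1, h2⟩
  obtain ⟨j, rfl | rfl⟩ := Nat.even_or_odd' i
  · rw [thueMorse_two_mul, thueMorse_two_mul_add_one] at h1
    exact fin_two_add_one_ne _ h1.symm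
  · rw [show 2 * j + 1 + 1 = 2 * (j + 1) by ring, show 2 * j + 1 + 2 = 2 * (j + 1) + 1 by ring,
      thueMorse_two_mul, thueMorse_two_mul_add_one] at h2
    exact fin_two_add_one_ne _ h2.symm

theorem length_le_two_of_const {n : ℕ} {p w s : List (Fin 2)} {c : Fin 2}
    (h : p ++ w ++ s ∈ wordFactors thueMorse n) (hc : ∀ d ∈ w, d = c) : w.length ≤ 2 := by
  obtain ⟨i, hi⟩ := mem_wordFactors_of_append h
  by_contra! hlt
  obtain ⟨m, hm⟩ := Nat.exists_eq_add_of_le hlt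
  simp only [hm, show 2 + 1 + m = m + 1 + 1 + 1 by ring, wordBlock_succ] at hi
  rw [← hi] at hc
  simp only [List.mem_cons, forall_eq_or_imp] at hc
  exact thueMorse_no_cube i ⟨by rw [hc.1, hc.2.1], by rw [hc.2.1, hc.2.2.1]⟩

theorem not_const_of_mem_wordFactors {n : ℕ} {w : List (Fin 2)} (hn : 3 ≤ n)
    (h : w ∈ wordFactors thueMorse n) (c : Fin 2) : ¬ ∀ d ∈ w, d = c := by
  intro hc
  have := length_le_two_of_const (p := []) (s := []) (by simpa using h) hc
  have := length_of_mem_wordFactors h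
  omega

theorem wordFactors_two_mul {n : ℕ} :
    wordFactors thueMorse (2 * n) = thueMap '' wordFactors thueMorse n ∪
      (fun u => (thueMap u).tail.dropLast) '' wordFactors thueMorse (n + 1) := by
  have key (i : ℕ) : (thueMap (wordBlock thueMorse i (n + 1))).tail.dropLast =
      wordBlock thueMorse (2 * i + 1) (2 * n) := by
    rw [thueMap_wordBlock, show 2 * (n + 1) = 2 * n + 1 + 1 by ring, tail_wordBlock,
      dropLast_wordBlock]
  ext w
  constructor
  · rintro ⟨i, rfl⟩
    obtain ⟨j, rfl | rfl⟩ := Nat.even_or_odd' i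
    · exact Or.inl ⟨_, ⟨j, rfl⟩, thueMap_wordBlock j n⟩
    · exact Or.inr ⟨_, ⟨j, rfl⟩, key j⟩
  · rintro (⟨_, ⟨j, rfl⟩, rfl⟩ | ⟨_, ⟨j, rfl⟩, rfl⟩)
    · exact ⟨2 * j, (thueMap_wordBlock j n).symm⟩
    · exact ⟨2 * j + 1, (key j).symm⟩

theorem wordFactors_two_mul_add_one {n : ℕ} :
    wordFactors thueMorse (2 * n + 1) =
      (fun u => (thueMap u).dropLast) '' wordFactors thueMorse (n + 1) ∪
      (fun u => (thueMap u).tail) '' wordFactors thueMorse (n + 1) := by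
  have key₁ (i : ℕ) : (thueMap (wordBlock thueMorse i (n + 1))).dropLast =
      wordBlock thueMorse (2 * i) (2 * n + 1) := by
    rw [thueMap_wordBlock, show 2 * (n + 1) = 2 * n + 1 + 1 by ring, dropLast_wordBlock]
  have key₂ (i : ℕ) : (thueMap (wordBlock thueMorse i (n + 1))).tail =
      wordBlock thueMorse (2 * i + 1) (2 * n + 1) := by
    rw [thueMap_wordBlock, show 2 * (n + 1) = 2 * n + 1 + 1 by ring, tail_wordBlock]
  ext w
  constructor
  · rintro ⟨i, rfl⟩
    obtain ⟨j, rfl | rfl⟩ := Nat.even_or_odd' i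
    · exact Or.inl ⟨_, ⟨j, rfl⟩, key₁ j⟩
    · exact Or.inr ⟨_, ⟨j, rfl⟩, key₂ j⟩
  · rintro (⟨_, ⟨j, rfl⟩, rfl⟩ | ⟨_, ⟨j, rfl⟩, rfl⟩)
    · exact ⟨2 * j, (key₁ j).symm⟩
    · exact ⟨2 * j + 1, (key₂ j).symm⟩

theorem exists_eq_cons_concat {α : Type*} {w : List α} (h : 2 ≤ w.length) :
    ∃ a v b, w = a :: (v ++ [b]) := by
  match w, h with
  | a :: c :: l, _ =>
    exact ⟨a, (c :: l).dropLast, (c :: l).getLast (by simp), by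
      rw [List.dropLast_append_getLast]⟩

theorem exists_eq_concat {α : Type*} {w : List α} (h : 1 ≤ w.length) :
    ∃ v b, w = v ++ [b] :=
  ⟨w.dropLast, w.getLast (by rintro rfl; simp at h), by rw [List.dropLast_append_getLast]⟩

@[simp] theorem tail_dropLast_thueMap (a b : Fin 2) (v : List (Fin 2)) :
    (thueMap (a :: (v ++ [b]))).tail.dropLast = (a + 1) :: (thueMap v ++ [b]) := by
  have : (thueMap (a :: (v ++ [b]))).tail = ((a + 1) :: (thueMap v ++ [b])) ++ [b + 1] := by simp
  rw [this, List.dropLast_concat]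

@[simp] theorem dropLast_thueMap_concat (b : Fin 2) (v : List (Fin 2)) :
    (thueMap (v ++ [b])).dropLast = thueMap v ++ [b] := by
  have : thueMap (v ++ [b]) = (thueMap v ++ [b]) ++ [b + 1] := by simp
  rw [this, List.dropLast_concat]

theorem thueMap_append_singleton_inj {v v' : List (Fin 2)} {b b' : Fin 2}
    (h : thueMap v ++ [b] = thueMap v' ++ [b']) : v = v' ∧ b = b' := by
  have h1 := List.append_inj' h rfl
  exact ⟨thueMap_injective h1.1, by simpa using h1.2⟩

/-! ### Counting factors by their end letters -/

/-- A word has equal ends if its first and last letters agree. -/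
def EqualEnds (w : List (Fin 2)) : Prop := w.head? = w.getLast?

@[simp] theorem equalEnds_cons_concat {a b : Fin 2} {v : List (Fin 2)} :
    EqualEnds (a :: (v ++ [b])) ↔ a = b := by
  rw [EqualEnds, ← List.cons_append, List.getLast?_concat]
  simp

theorem equalEnds_thueMap {u : List (Fin 2)} (h : 2 ≤ u.length) :
    EqualEnds (thueMap u) ↔ ¬ EqualEnds u := by
  obtain ⟨a, v, b, rfl⟩ := exists_eq_cons_concat h
  have : thueMap (a :: (v ++ [b])) = a :: (((a + 1) :: (thueMap v ++ [b])) ++ [b + 1]) := by simp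
  rw [this, equalEnds_cons_concat, equalEnds_cons_concat]
  exact fin_two_ne_iff.symm

theorem equalEnds_tail_dropLast_thueMap {u : List (Fin 2)} (h : 2 ≤ u.length) :
    EqualEnds (thueMap u).tail.dropLast ↔ ¬ EqualEnds u := by
  obtain ⟨a, v, b, rfl⟩ := exists_eq_cons_concat h
  rw [tail_dropLast_thueMap, equalEnds_cons_concat, equalEnds_cons_concat]
  clear h
  decide +revert

theorem equalEnds_dropLast_thueMap {u : List (Fin 2)} (h : 2 ≤ u.length) :
    EqualEnds (thueMap u).dropLast ↔ EqualEnds u := by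
  obtain ⟨a, v, b, rfl⟩ := exists_eq_cons_concat h
  have : thueMap (a :: (v ++ [b])) = a :: ((((a + 1) :: thueMap v) ++ [b])) ++ [b + 1] := by simp
  rw [this, List.dropLast_concat, equalEnds_cons_concat, equalEnds_cons_concat]

theorem equalEnds_tail_thueMap {u : List (Fin 2)} (h : 2 ≤ u.length) :
    EqualEnds (thueMap u).tail ↔ EqualEnds u := by
  obtain ⟨a, v, b, rfl⟩ := exists_eq_cons_concat h
  have : (thueMap (a :: (v ++ [b]))).tail = (a + 1) :: ((thueMap v ++ [b]) ++ [b + 1]) := by simp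
  rw [this, equalEnds_cons_concat, equalEnds_cons_concat]
  exact add_left_inj 1

/-- A double alignment would force `w` to be constant. This makes the two families of factors, at
even and odd positions, disjoint. -/
theorem tail_dropLast_thueMap_notMem_range {n : ℕ} (hn : 3 ≤ n) {w : List (Fin 2)}
    (hw : w ∈ wordFactors thueMorse n) : (thueMap w).tail.dropLast ∉ Set.range thueMap := by
  obtain ⟨a, v, b, rfl⟩ :=
    exists_eq_cons_concat (w := w) (by rw [length_of_mem_wordFactors hw]; omega)
  rw [tail_dropLast_thueMap, cons_thueMap_concat_mem_range]
  rintro ⟨hv, rfl⟩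
  refine not_const_of_mem_wordFactors hn hw a fun d hd => ?_
  simp only [List.mem_cons, List.mem_append, List.not_mem_nil, or_false] at hd
  rcases hd with rfl | hd | rfl
  · rfl
  · simpa using hv d hd
  · simp

theorem injOn_tail_dropLast_thueMap {n : ℕ} (hn : 2 ≤ n) :
    Set.InjOn (fun u => (thueMap u).tail.dropLast) (wordFactors thueMorse n) := by
  intro u hu u' hu' h
  obtain ⟨a, v, b, rfl⟩ :=
    exists_eq_cons_concat (w := u) (by rw [length_of_mem_wordFactors hu]; omega)
  obtain ⟨a', v', b', rfl⟩ :=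
    exists_eq_cons_concat (w := u') (by rw [length_of_mem_wordFactors hu']; omega)
  simp only [tail_dropLast_thueMap, List.cons.injEq, add_left_inj] at h
  obtain ⟨rfl, rfl⟩ := thueMap_append_singleton_inj h.2
  rw [h.1]

theorem injOn_dropLast_thueMap {n : ℕ} (hn : 1 ≤ n) :
    Set.InjOn (fun u => (thueMap u).dropLast) (wordFactors thueMorse n) := by
  intro u hu u' hu' h
  obtain ⟨v, b, rfl⟩ := exists_eq_concat (w := u) (by rw [length_of_mem_wordFactors hu]; omega)
  obtain ⟨v', b', rfl⟩ := exists_eq_concat (w := u') (by rw [length_of_mem_wordFactors hu']; omega)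
  simp only [dropLast_thueMap_concat] at h
  obtain ⟨rfl, rfl⟩ := thueMap_append_singleton_inj h
  rfl

theorem injOn_tail_thueMap {n : ℕ} (hn : 1 ≤ n) :
    Set.InjOn (fun u => (thueMap u).tail) (wordFactors thueMorse n) := by
  intro u hu u' hu' h
  match u, u', length_of_mem_wordFactors hu, length_of_mem_wordFactors hu' with
  | [], _, h1, _ => simp at h1; omega
  | _, [], _, h1 => simp at h1; omega
  | a :: v, a' :: v', _, _ =>
    simp only [thueMap_cons, List.tail_cons, List.cons.injEq, add_left_inj] at h
    rw [h.1, thueMap_injective h.2]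

theorem ncard_image_union_image {α β γ : Type*} {f : α → γ} {g : β → γ} {A : Set α} {B : Set β}
    (hA : A.Finite) (hB : B.Finite) (hf : A.InjOn f) (hg : B.InjOn g)
    (h : ∀ a ∈ A, ∀ b ∈ B, f a ≠ g b) : (f '' A ∪ g '' B).ncard = A.ncard + B.ncard := by
  rw [Set.ncard_union_eq _ (hA.image f) (hB.image g), hf.ncard_image, hg.ncard_image]
  rw [Set.disjoint_left]
  rintro _ ⟨a, ha, rfl⟩ ⟨b, hb, hab⟩
  exact h a ha b hb hab.symm

theorem finite_setOf_mem_wordFactors_and (n : ℕ) (P : List (Fin 2) → Prop) :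
    {w | w ∈ wordFactors thueMorse n ∧ P w}.Finite :=
  (wordFactors_finite thueMorse n).subset fun _ h => h.1

/-- The predicates `P` and `Q` are left free so that one count serves both end-letter conditions; on
even lengths these two get exchanged, on odd lengths preserved. -/
theorem ncard_wordFactors_two_mul {n : ℕ} (hn : 2 ≤ n) {P Q : List (Fin 2) → Prop}
    (h₁ : ∀ u ∈ wordFactors thueMorse n, P (thueMap u) ↔ Q u)
    (h₂ : ∀ u ∈ wordFactors thueMorse (n + 1), P (thueMap u).tail.dropLast ↔ Q u) :
    {w | w ∈ wordFactors thueMorse (2 * n) ∧ P w}.ncard =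
      {w | w ∈ wordFactors thueMorse n ∧ Q w}.ncard +
        {w | w ∈ wordFactors thueMorse (n + 1) ∧ Q w}.ncard := by
  rw [← ncard_image_union_image (f := thueMap) (g := fun u => (thueMap u).tail.dropLast)
    (finite_setOf_mem_wordFactors_and _ _) (finite_setOf_mem_wordFactors_and _ _)
    thueMap_injective.injOn
    ((injOn_tail_dropLast_thueMap (n := n + 1) (by omega)).mono fun _ h => h.1)]
  · congr 1
    ext w
    rw [wordFactors_two_mul]
    constructor
    · rintro ⟨⟨u, hu, rfl⟩ | ⟨u, hu, rfl⟩, h⟩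
      · exact Or.inl ⟨u, ⟨hu, (h₁ u hu).1 h⟩, rfl⟩
      · exact Or.inr ⟨u, ⟨hu, (h₂ u hu).1 h⟩, rfl⟩
    · rintro (⟨u, ⟨hu, h⟩, rfl⟩ | ⟨u, ⟨hu, h⟩, rfl⟩)
      · exact ⟨Or.inl ⟨u, hu, rfl⟩, (h₁ u hu).2 h⟩
      · exact ⟨Or.inr ⟨u, hu, rfl⟩, (h₂ u hu).2 h⟩
  · rintro u - w ⟨hw, -⟩ h
    exact tail_dropLast_thueMap_notMem_range (by omega) hw ⟨u, h⟩

theorem ncard_wordFactors_two_mul_add_one {n : ℕ} (hn : 2 ≤ n) {P Q : List (Fin 2) → Prop}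
    (h₁ : ∀ u ∈ wordFactors thueMorse (n + 1), P (thueMap u).dropLast ↔ Q u)
    (h₂ : ∀ u ∈ wordFactors thueMorse (n + 1), P (thueMap u).tail ↔ Q u) :
    {w | w ∈ wordFactors thueMorse (2 * n + 1) ∧ P w}.ncard =
      2 * {w | w ∈ wordFactors thueMorse (n + 1) ∧ Q w}.ncard := by
  rw [two_mul (Set.ncard _), ← ncard_image_union_image (f := fun u => (thueMap u).dropLast)
    (g := fun u => (thueMap u).tail)
    (finite_setOf_mem_wordFactors_and _ _) (finite_setOf_mem_wordFactors_and _ _)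
    ((injOn_dropLast_thueMap (n := n + 1) (by omega)).mono fun _ h => h.1)
    ((injOn_tail_thueMap (n := n + 1) (by omega)).mono fun _ h => h.1)]
  · congr 1
    ext w
    rw [wordFactors_two_mul_add_one]
    constructor
    · rintro ⟨⟨u, hu, rfl⟩ | ⟨u, hu, rfl⟩, h⟩
      · exact Or.inl ⟨u, ⟨hu, (h₁ u hu).1 h⟩, rfl⟩
      · exact Or.inr ⟨u, ⟨hu, (h₂ u hu).1 h⟩, rfl⟩
    · rintro (⟨u, ⟨hu, h⟩, rfl⟩ | ⟨u, ⟨hu, h⟩, rfl⟩)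
      · exact ⟨Or.inl ⟨u, hu, rfl⟩, (h₁ u hu).2 h⟩
      · exact ⟨Or.inr ⟨u, hu, rfl⟩, (h₂ u hu).2 h⟩
  · rintro u ⟨hu, -⟩ w ⟨hw, -⟩ h
    obtain ⟨v, b, rfl⟩ := exists_eq_concat (w := u) (by rw [length_of_mem_wordFactors hu]; omega)
    refine tail_dropLast_thueMap_notMem_range (by omega) hw ⟨v, ?_⟩
    simp only [dropLast_thueMap_concat] at h
    rw [← h, List.dropLast_concat]

/-- The number of length-`n` factors of the Thue–Morse word with equal end letters. -/
noncomputable def equalEndsCount (n : ℕ) : ℕ :=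
  {w | w ∈ wordFactors thueMorse n ∧ EqualEnds w}.ncard

/-- The number of length-`n` factors of the Thue–Morse word with distinct end letters. -/
noncomputable def distinctEndsCount (n : ℕ) : ℕ :=
  {w | w ∈ wordFactors thueMorse n ∧ ¬ EqualEnds w}.ncard

theorem equalEndsCount_add_distinctEndsCount (n : ℕ) :
    equalEndsCount n + distinctEndsCount n = (wordFactors thueMorse n).ncard := by
  rw [equalEndsCount, distinctEndsCount, ← Set.ncard_union_eq _
    (finite_setOf_mem_wordFactors_and _ _) (finite_setOf_mem_wordFactors_and _ _)]
  · congr 1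
    ext w
    simp only [Set.mem_union, Set.mem_ofPred_eq]
    tauto
  · rw [Set.disjoint_left]
    exact fun w h h' => h'.2 h.2

theorem equalEndsCount_two_mul {n : ℕ} (hn : 2 ≤ n) :
    equalEndsCount (2 * n) = distinctEndsCount n + distinctEndsCount (n + 1) :=
  ncard_wordFactors_two_mul hn
    (fun _ hu => equalEnds_thueMap (by rw [length_of_mem_wordFactors hu]; omega))
    (fun _ hu => equalEnds_tail_dropLast_thueMap (by rw [length_of_mem_wordFactors hu]; omega))

theorem distinctEndsCount_two_mul {n : ℕ} (hn : 2 ≤ n) :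
    distinctEndsCount (2 * n) = equalEndsCount n + equalEndsCount (n + 1) :=
  ncard_wordFactors_two_mul hn
    (fun _ hu => not_iff_comm.1
      (equalEnds_thueMap (by rw [length_of_mem_wordFactors hu]; omega)).symm)
    (fun _ hu => not_iff_comm.1
      (equalEnds_tail_dropLast_thueMap (by rw [length_of_mem_wordFactors hu]; omega)).symm)

theorem equalEndsCount_two_mul_add_one {n : ℕ} (hn : 2 ≤ n) :
    equalEndsCount (2 * n + 1) = 2 * equalEndsCount (n + 1) :=
  ncard_wordFactors_two_mul_add_one hn
    (fun _ hu => equalEnds_dropLast_thueMap (by rw [length_of_mem_wordFactors hu]; omega))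
    (fun _ hu => equalEnds_tail_thueMap (by rw [length_of_mem_wordFactors hu]; omega))

theorem distinctEndsCount_two_mul_add_one {n : ℕ} (hn : 2 ≤ n) :
    distinctEndsCount (2 * n + 1) = 2 * distinctEndsCount (n + 1) :=
  ncard_wordFactors_two_mul_add_one hn
    (fun _ hu => not_congr
      (equalEnds_dropLast_thueMap (by rw [length_of_mem_wordFactors hu]; omega)))
    (fun _ hu => not_congr
      (equalEnds_tail_thueMap (by rw [length_of_mem_wordFactors hu]; omega)))

/-- By the recursions, the increment at `2n` equals the one at `n`, and the increment at `2n + 1`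
equals the one at `n + 1`, so all increments reduce to those at 2 and 3. -/
theorem exists_ncard_wordFactors_succ_le :
    ∃ C, ∀ n, 2 ≤ n →
      (wordFactors thueMorse (n + 1)).ncard ≤ (wordFactors thueMorse n).ncard + C := by
  have h₀ {n : ℕ} (hn : 2 ≤ n) : (wordFactors thueMorse (2 * n)).ncard =
      (wordFactors thueMorse n).ncard + (wordFactors thueMorse (n + 1)).ncard := by
    simp only [← equalEndsCount_add_distinctEndsCount, equalEndsCount_two_mul hn,
      distinctEndsCount_two_mul hn]
    ring
  have h₁ {n : ℕ} (hn : 2 ≤ n) : (wordFactors thueMorse (2 * n + 1)).ncard =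
      2 * (wordFactors thueMorse (n + 1)).ncard := by
    simp only [← equalEndsCount_add_distinctEndsCount, equalEndsCount_two_mul_add_one hn,
      distinctEndsCount_two_mul_add_one hn]
    ring
  refine ⟨(wordFactors thueMorse 3).ncard + (wordFactors thueMorse 4).ncard, fun n => ?_⟩
  induction n using Nat.strong_induction_on with
  | _ n ih =>
    intro hn
    obtain ⟨m, rfl | rfl⟩ := Nat.even_or_odd' n
    · obtain rfl | hm : m = 1 ∨ 2 ≤ m := by omega
      · simp only [Nat.reduceMul, Nat.reduceAdd]; omega
      · have := ih m (by omega) hm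
        rw [h₀ hm, h₁ hm]
        omega
    · obtain rfl | hm : m = 1 ∨ 2 ≤ m := by omega
      · simp only [Nat.reduceMul, Nat.reduceAdd]; omega
      · have := ih (m + 1) (by omega) (by omega)
        rw [h₁ hm, show 2 * m + 1 + 1 = 2 * (m + 1) by ring, h₀ (by omega)]
        omega

/-! ### Small lengths and linear lower bounds for the end-letter counts -/

theorem le_ncard_of_wordBlock {n : ℕ} {P : List (Fin 2) → Prop} (s : Finset ℕ)
    (hs : Set.InjOn (fun i => wordBlock thueMorse i n) s)
    (hP : ∀ i ∈ s, P (wordBlock thueMorse i n)) :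
    s.card ≤ {w | w ∈ wordFactors thueMorse n ∧ P w}.ncard := by
  rw [← Set.ncard_coe_finset, ← hs.ncard_image]
  refine Set.ncard_le_ncard ?_ (finite_setOf_mem_wordFactors_and _ _)
  rintro _ ⟨i, hi, rfl⟩
  exact ⟨⟨i, rfl⟩, hP i hi⟩

theorem equalEndsCount_two : equalEndsCount 2 = 2 := by
  refine le_antisymm ?_ (le_ncard_of_wordBlock {1, 5} ?_ ?_)
  · have h2 : ({[0, 0], [1, 1]} : Set (List (Fin 2))).ncard = 2 := Set.ncard_pair (by decide)
    refine (Set.ncard_le_ncard ?_ (Set.toFinite _)).trans h2.le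
    rintro w ⟨hw, h⟩
    have hl := length_of_mem_wordFactors hw
    obtain ⟨a, v, b, rfl⟩ := exists_eq_cons_concat hl.ge
    obtain rfl : v = [] := by simpa using hl
    obtain rfl := equalEnds_cons_concat.1 h
    clear hl h2 h hw
    decide +revert
  · simp [Set.InjOn, wordBlock, thueMorse, List.range_succ]
  · simp [wordBlock, thueMorse, EqualEnds, List.range_succ]

theorem equalEndsCount_three : equalEndsCount 3 = 2 := by
  refine le_antisymm ?_ (le_ncard_of_wordBlock {2, 3} ?_ ?_)
  · have h2 : ({[0, 1, 0], [1, 0, 1]} : Set (List (Fin 2))).ncard = 2 := Set.ncard_pair (by decide)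
    refine (Set.ncard_le_ncard ?_ (Set.toFinite _)).trans h2.le
    rintro w ⟨hw, h⟩
    have hl := length_of_mem_wordFactors hw
    obtain ⟨a, v, b, rfl⟩ := exists_eq_cons_concat (w := w) (by omega)
    obtain ⟨c, rfl⟩ : ∃ c, v = [c] := List.length_eq_one_iff.1 (by simpa using hl)
    obtain rfl := equalEnds_cons_concat.1 h
    have hac : c ≠ a := fun hac => not_const_of_mem_wordFactors le_rfl hw a (by simp [hac])
    clear hl h2 h hw
    decide +revert
  · simp [Set.InjOn, wordBlock, thueMorse, List.range_succ]
  · simp [wordBlock, thueMorse, EqualEnds, List.range_succ]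

theorem two_le_distinctEndsCount_two : 2 ≤ distinctEndsCount 2 := by
  refine le_ncard_of_wordBlock {0, 2} ?_ ?_
  · simp [Set.InjOn, wordBlock, thueMorse, List.range_succ]
  · simp [wordBlock, thueMorse, EqualEnds, List.range_succ]

theorem four_le_distinctEndsCount_three : 4 ≤ distinctEndsCount 3 := by
  refine le_ncard_of_wordBlock {0, 1, 4, 5} ?_ ?_
  · simp [Set.InjOn, wordBlock, thueMorse, List.range_succ]
  · simp [wordBlock, thueMorse, EqualEnds, List.range_succ]

/-- Only the third bound is needed later; the other two make the induction close. For odd `k`,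
`distinctEndsCount (k + 1)` is a sum of two consecutive values of `equalEndsCount`, for which the
first bound is too weak. Unfolding these once more leaves one term for each of the three bounds, and
these add up to exactly `4 * k / 3`. -/
theorem endsCount_bounds (k : ℕ) (hk : 1 ≤ k) :
    k ≤ equalEndsCount (k + 1) ∧ 3 * k ≤ equalEndsCount (k + 1) + distinctEndsCount (k + 1) ∧
      4 * k ≤ 3 * distinctEndsCount (k + 1) := by
  have b₁ := equalEndsCount_two
  have b₂ := two_le_distinctEndsCount_two
  have b₃ := equalEndsCount_three
  have b₄ := four_le_distinctEndsCount_three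
  induction k using Nat.strong_induction_on with
  | _ k ih =>
    obtain rfl | rfl | hk3 : k = 1 ∨ k = 2 ∨ 3 ≤ k := by omega
    · simp only [Nat.reduceAdd]; omega
    · simp only [Nat.reduceAdd]; omega
    obtain ⟨m, rfl | rfl⟩ := Nat.even_or_odd' k
    · have := ih m (by omega) (by omega)
      rw [equalEndsCount_two_mul_add_one (by omega), distinctEndsCount_two_mul_add_one (by omega)]
      omega
    · have h₁ := ih m (by omega) (by omega)
      have h₂ := ih (m + 1) (by omega) (by omega)
      rw [show 2 * m + 1 + 1 = 2 * (m + 1) by ring, equalEndsCount_two_mul (by omega),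
        distinctEndsCount_two_mul (by omega)]
      refine ⟨by omega, by omega, ?_⟩
      obtain rfl | hm : m = 1 ∨ 2 ≤ m := by omega
      · simp only [Nat.reduceAdd]; omega
      obtain ⟨q, rfl | rfl⟩ := Nat.even_or_odd' m
      · have h₃ := ih q (by omega) (by omega)
        have h₄ := ih (q + 1) (by omega) (by omega)
        rw [show 2 * q + 1 + 1 = 2 * (q + 1) by ring, equalEndsCount_two_mul (by omega)]
        obtain rfl | hq : q = 1 ∨ 2 ≤ q := by omega
        · simp only [Nat.reduceAdd, Nat.reduceMul]; omega
        · rw [equalEndsCount_two_mul_add_one hq]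
          omega
      · have h₃ := ih q (by omega) (by omega)
        have h₄ := ih (q + 1) (by omega) (by omega)
        rw [show 2 * q + 1 + 1 = 2 * (q + 1) by ring, equalEndsCount_two_mul_add_one (by omega),
          equalEndsCount_two_mul (by omega)]
        omega

/-! ### Factors of even length up to cyclic shift -/

theorem exists_append_of_isRotated {α : Type*} {l l' : List α} (h : l ~r l') :
    ∃ l₁ l₂, l = l₁ ++ l₂ ∧ l' = l₂ ++ l₁ := by
  obtain ⟨n, hn, rfl⟩ := List.isRotated_iff_mod.1 h
  exact ⟨l.take n, l.drop n, (List.take_append_drop n l).symm,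
    List.rotate_eq_drop_append_take hn⟩

theorem isRotated_thueMap {l l' : List (Fin 2)} (h : l ~r l') : thueMap l ~r thueMap l' := by
  obtain ⟨l₁, l₂, rfl, rfl⟩ := exists_append_of_isRotated h
  simpa using List.isRotated_append

/-- The Thue–Morse morphism on cyclic words. -/
def cycleThueMap : Cycle (Fin 2) → Cycle (Fin 2) :=
  Quotient.map thueMap fun _ _ => isRotated_thueMap

@[simp] theorem cycleThueMap_coe (l : List (Fin 2)) :
    cycleThueMap (l : Cycle (Fin 2)) = (thueMap l : Cycle (Fin 2)) := rfl

/-- A rotation cutting between blocks lifts to a rotation of `u`; one cutting inside a block gives a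
double alignment, hence a constant `u`. -/
theorem isRotated_of_isRotated_thueMap {n : ℕ} (hn : 3 ≤ n) {u u' : List (Fin 2)}
    (hu : u ∈ wordFactors thueMorse n) (h : thueMap u ~r thueMap u') : u ~r u' := by
  obtain ⟨l₁, l₂, h₁, h₂⟩ := exists_append_of_isRotated h
  rcases thueMap_eq_append h₁ with ⟨u₁, u₂, rfl, rfl, rfl⟩ | ⟨u₁, c, u₂, rfl, rfl, rfl⟩
  · rw [← thueMap_append] at h₂
    rw [thueMap_injective h₂]
    exact List.isRotated_append
  · exfalso
    have h₃ : (c + 1) :: (thueMap (u₂ ++ u₁) ++ [c]) ∈ Set.range thueMap := ⟨u', by simp [h₂]⟩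
    rw [cons_thueMap_concat_mem_range] at h₃
    refine not_const_of_mem_wordFactors hn hu c fun d hd => ?_
    simp only [List.mem_append, List.mem_cons, fin_two_add_one_add_one] at h₃ hd
    rcases hd with hd | hd | hd
    · exact h₃.1 d (Or.inr hd)
    · exact hd
    · exact h₃.1 d (Or.inl hd)

/-- Images under `thueMap` contain both letters equally often; the left-hand word has two extra
letters `b`. -/
theorem not_isRotated_thueMap_cons_cons {b : Fin 2} {u v : List (Fin 2)} :
    ¬ b :: b :: thueMap v ~r thueMap u := by
  intro h
  have hcount (w : List (Fin 2)) : (thueMap w).count b = w.length := by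
    induction w with
    | nil => rfl
    | cons a w ih =>
      rcases eq_or_ne a b with rfl | hab
      · simp [ih]
      · simp [ih, fin_two_ne_iff.1 hab]
  have h₁ := h.perm.count_eq b
  have h₂ := h.perm.length_eq
  simp only [List.count_cons_self, hcount, List.length_cons, length_thueMap] at h₁ h₂
  omega

/-- The doubled letter marks where the block decomposition starts. A nontrivial rotation of the same
shape would force long constant runs in the factor `(b + 1) v b`. -/
theorem eq_of_isRotated_cons_cons_thueMap {n : ℕ} (hn : 5 ≤ n) {b b' : Fin 2}
    {v v' : List (Fin 2)} (hv : (b + 1) :: (v ++ [b]) ∈ wordFactors thueMorse n)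
    (h : b :: b :: thueMap v ~r b' :: b' :: thueMap v') : b = b' ∧ v = v' := by
  have hl := length_of_mem_wordFactors hv
  simp only [List.length_cons, List.length_append, List.length_nil] at hl
  have hconst {p w s : List (Fin 2)} {c : Fin 2} (he : (b + 1) :: (v ++ [b]) = p ++ w ++ s)
      (hc : ∀ d ∈ w, d = c) : w.length ≤ 2 := length_le_two_of_const (he ▸ hv) hc
  obtain ⟨l₁, l₂, h₁, h₂⟩ := exists_append_of_isRotated h
  match l₁, h₁, h₂ with
  | [], h₁, h₂ =>
    simp only [List.nil_append, List.append_nil] at h₁ h₂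
    subst h₁
    simp only [List.cons.injEq] at h₂
    exact ⟨h₂.1.symm, (thueMap_injective h₂.2.2).symm⟩
  | [c], h₁, h₂ =>
    simp only [List.cons_append, List.nil_append, List.cons.injEq] at h₁
    obtain ⟨rfl, rfl⟩ := h₁
    cases v with
    | nil => simp at hl; omega
    | cons d v =>
      simp only [thueMap_cons, List.cons_append, List.cons.injEq] at h₂
      obtain ⟨rfl, rfl, h₂⟩ := h₂
      have h₃ : (b' + 1) :: (thueMap v ++ [b']) ∈ Set.range thueMap := ⟨v', h₂⟩
      rw [cons_thueMap_concat_mem_range, fin_two_add_one_add_one] at h₃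
      have := hconst (p := [b' + 1]) (w := b' :: v) (s := [b']) (c := b') (by simp)
        (by simpa using h₃.1)
      simp only [List.length_cons] at this hl
      omega
  | c :: c' :: l₁, h₁, h₂ =>
    simp only [List.cons_append, List.cons.injEq] at h₁
    obtain ⟨rfl, rfl, h₁⟩ := h₁
    rcases thueMap_eq_append h₁ with ⟨v₁, v₂, rfl, rfl, rfl⟩ | ⟨v₁, c, v₂, rfl, rfl, rfl⟩
    · cases v₂ with
      | nil =>
        simp only [thueMap_nil, List.nil_append, List.cons.injEq] at h₂
        exact ⟨h₂.1.symm, by simpa using (thueMap_injective h₂.2.2).symm⟩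
      | cons d v₂ =>
        simp only [thueMap_cons, List.cons_append, List.cons.injEq] at h₂
        exact absurd (h₂.2.1.symm.trans h₂.1) (fin_two_add_one_ne d)
    · cases v₂ with
      | nil =>
        simp only [thueMap_nil, List.cons_append, List.nil_append, List.cons.injEq] at h₂
        have h₃ : b :: (thueMap v₁ ++ [c]) ∈ Set.range thueMap := ⟨v', h₂.2.2⟩
        rw [cons_thueMap_concat_mem_range] at h₃
        have := hconst (p := []) (w := (b + 1) :: (v₁ ++ [c])) (s := [b]) (c := b + 1) (by simp)
          (by
            intro d hd
            simp only [List.mem_cons, List.mem_append, List.not_mem_nil, or_false] at hd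
            rcases hd with rfl | hd | rfl
            exacts [rfl, h₃.1 d hd, h₃.2])
        simp only [List.length_cons, List.length_append, List.length_nil] at this hl
        omega
      | cons d v₂ =>
        simp only [thueMap_cons, List.cons_append, List.cons.injEq] at h₂
        have h₃ : (d + 1) :: (thueMap v₂ ++ (b :: b :: (thueMap v₁ ++ [c]))) ∈
          Set.range thueMap := ⟨v', h₂.2.2⟩
        rw [cons_thueMap_append_mem_range, cons_cons_mem_range_thueMap,
          cons_thueMap_concat_mem_range, fin_two_add_one_add_one] at h₃
        obtain ⟨h₃, rfl, h₄, rfl⟩ := h₃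
        -- The factor is now a run of `b + 1` followed by a run of `b`. Each has length at most 2,
        -- against total length at least 5.
        have k₁ := hconst (p := []) (w := (b + 1) :: (v₁ ++ [b + 1])) (s := b :: (v₂ ++ [b]))
          (c := b + 1) (by simp)
          (by
            intro d hd
            simp only [List.mem_cons, List.mem_append, List.not_mem_nil, or_false] at hd
            rcases hd with rfl | hd | rfl
            exacts [rfl, h₄ d hd, rfl])
        have k₂ := hconst (p := (b + 1) :: (v₁ ++ [b + 1])) (w := b :: (v₂ ++ [b])) (s := [])
          (c := b) (by simp)
          (by
            intro d hd
            simp only [List.mem_cons, List.mem_append, List.not_mem_nil, or_false] at hd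
            rcases hd with rfl | hd | rfl
            exacts [rfl, h₃ d hd, rfl])
        simp only [List.length_cons, List.length_append, List.length_nil] at k₁ k₂ hl
        omega

theorem exists_of_not_equalEnds {w : List (Fin 2)} (hw : 2 ≤ w.length) (h : ¬ EqualEnds w) :
    ∃ b v, w = (b + 1) :: (v ++ [b]) ∧ (thueMap w).tail.dropLast ~r b :: b :: thueMap v := by
  obtain ⟨a, v, b, rfl⟩ := exists_eq_cons_concat hw
  rw [equalEnds_cons_concat] at h
  obtain rfl := fin_two_ne_iff.1 h
  refine ⟨b, v, rfl, ?_⟩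
  rw [tail_dropLast_thueMap, fin_two_add_one_add_one]
  exact (List.isRotated_append (l := b :: thueMap v) (l' := [b]))

/-- Words `a v a` with equal ends contribute nothing new: trimming both ends of their image gives a
conjugate of `thueMap (a :: v)`. -/
theorem cyclicFactors_two_mul {n : ℕ} (hn : 1 ≤ n) :
    cyclicFactors thueMorse (2 * n) = cycleThueMap '' cyclicFactors thueMorse n ∪
      (fun w : List (Fin 2) => ((thueMap w).tail.dropLast : Cycle (Fin 2))) ''
        {w | w ∈ wordFactors thueMorse (n + 1) ∧ ¬ EqualEnds w} := by
  ext x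
  constructor
  · rintro ⟨w, hw, rfl⟩
    rw [wordFactors_two_mul] at hw
    rcases hw with ⟨u, hu, rfl⟩ | ⟨u, hu, rfl⟩
    · exact Or.inl ⟨u, ⟨u, hu, rfl⟩, rfl⟩
    · by_cases he : EqualEnds u
      · obtain ⟨a, v, b, rfl⟩ :=
          exists_eq_cons_concat (w := u) (by rw [length_of_mem_wordFactors hu]; omega)
        obtain rfl := equalEnds_cons_concat.1 he
        refine Or.inl ⟨_, ⟨a :: v, mem_wordFactors_of_concat (by simpa using hu), rfl⟩, ?_⟩
        rw [cycleThueMap_coe]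
        simp only [tail_dropLast_thueMap]
        exact Cycle.coe_eq_coe.2 (List.isRotated_append (l := [a]) (l' := (a + 1) :: thueMap v))
      · exact Or.inr ⟨u, ⟨hu, he⟩, rfl⟩
  · rintro (⟨_, ⟨u, hu, rfl⟩, rfl⟩ | ⟨u, ⟨hu, -⟩, rfl⟩)
    · exact ⟨thueMap u, wordFactors_two_mul ▸ Or.inl ⟨u, hu, rfl⟩, rfl⟩
    · exact ⟨_, wordFactors_two_mul ▸ Or.inr ⟨u, hu, rfl⟩, rfl⟩

theorem cyclicComplexity_two_mul {n : ℕ} (hn : 4 ≤ n) :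
    cyclicComplexity thueMorse (2 * n) =
      cyclicComplexity thueMorse n + distinctEndsCount (n + 1) := by
  have key {w : List (Fin 2)} (hw : w ∈ wordFactors thueMorse (n + 1) ∧ ¬ EqualEnds w) :=
    exists_of_not_equalEnds (w := w) (by rw [length_of_mem_wordFactors hw.1]; omega) hw.2
  rw [cyclicComplexity, cyclicFactors_two_mul (by omega), ncard_image_union_image
    (cyclicFactors_finite _ _) (finite_setOf_mem_wordFactors_and _ _), cyclicComplexity,
    distinctEndsCount]
  · rintro _ ⟨u, hu, rfl⟩ _ ⟨u', -, rfl⟩ h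
    exact Cycle.coe_eq_coe.2 (isRotated_of_isRotated_thueMap (by omega) hu (Cycle.coe_eq_coe.1 h))
  · intro w hw w' hw' h
    obtain ⟨b, v, rfl, hr⟩ := key hw
    obtain ⟨b', v', rfl, hr'⟩ := key hw'
    obtain ⟨rfl, rfl⟩ := eq_of_isRotated_cons_cons_thueMap (n := n + 1) (by omega) hw.1
      (hr.symm.trans ((Cycle.coe_eq_coe.1 h).trans hr'))
    rfl
  · rintro _ ⟨u, hu, rfl⟩ w hw h
    obtain ⟨b, v, rfl, hr⟩ := key hw
    exact not_isRotated_thueMap_cons_cons (hr.symm.trans (Cycle.coe_eq_coe.1 h).symm)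

/-! ### Factors of odd length up to cyclic shift -/

theorem eq_replicate_of_thueMap_append {v₁ v₂ v : List (Fin 2)} {b b' : Fin 2}
    (h : thueMap v₂ ++ b :: thueMap v₁ = thueMap v ++ [b']) :
    b' = b ∧ v₁ = List.replicate v₁.length (b + 1) ∧ v = v₂ ++ List.replicate v₁.length b := by
  induction v₂ generalizing v with
  | nil =>
    induction v₁ generalizing v with
    | nil => cases v with
      | nil => simpa using h.symm
      | cons d v => simp at h
    | cons c w ih => cases v with
      | nil => simp at h
      | cons d v =>
        simp only [thueMap_cons, thueMap_nil, List.nil_append, List.cons_append,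
          List.cons.injEq] at h ih
        obtain ⟨rfl, rfl, h⟩ := h
        rw [fin_two_add_one_add_one] at h
        obtain ⟨rfl, h₁, h₂⟩ := ih h
        refine ⟨rfl, ?_, ?_⟩
        · rw [List.length_cons, List.replicate_succ, ← h₁]
        · rw [List.length_cons, List.replicate_succ, h₂]; rfl
  | cons c v₂ ih => cases v with
    | nil => simp at h
    | cons d v =>
      simp only [thueMap_cons, List.cons_append, List.cons.injEq] at h
      obtain ⟨rfl, -, h⟩ := h
      obtain ⟨rfl, h₁, rfl⟩ := ih h
      exact ⟨rfl, h₁, rfl⟩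

/-- For `β = b + 1`, the identity `(βb)^i μ(z) b ~ μ(z) b (βb)^i = μ(z b^i) b` moves a prefix `β^i`
of `v` to the end as `b^i`. A cut between blocks does this to `v`, a cut inside a block does it to
`v'`. -/
theorem exists_replicate_of_isRotated {v v' : List (Fin 2)} {b b' : Fin 2}
    (h : thueMap v ++ [b] ~r thueMap v' ++ [b']) :
    b' = b ∧ ∃ i z, (v = List.replicate i (b + 1) ++ z ∧ v' = z ++ List.replicate i b) ∨
      (v' = List.replicate i (b + 1) ++ z ∧ v = z ++ List.replicate i b) := by
  obtain ⟨l₁, l₂, h₁, h₂⟩ := exists_append_of_isRotated h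
  rcases List.eq_nil_or_concat l₂ with rfl | ⟨l₂, c, rfl⟩
  · rw [List.append_nil] at h₁
    obtain ⟨rfl, rfl⟩ := thueMap_append_singleton_inj (h₂.trans h₁.symm)
    exact ⟨rfl, 0, v', by simp⟩
  · rw [List.concat_eq_append] at h₁ h₂
    rw [← List.append_assoc] at h₁
    obtain ⟨k₁, hc⟩ := List.append_inj' h₁ rfl
    obtain rfl : b = c := by simpa using hc
    rcases thueMap_eq_append k₁ with ⟨v₁, v₂, rfl, rfl, rfl⟩ | ⟨v₁, c, v₂, rfl, rfl, rfl⟩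
    · obtain ⟨rfl, h₃, rfl⟩ := eq_replicate_of_thueMap_append (v₁ := v₁) (v₂ := v₂) (v := v')
        (b := b) (b' := b') (by simpa using h₂.symm)
      exact ⟨rfl, v₁.length, v₂, Or.inl ⟨by rw [← h₃], rfl⟩⟩
    · rw [← List.append_assoc] at h₂
      obtain ⟨k₂, hc⟩ := List.append_inj' h₂ rfl
      obtain rfl : b' = c := by simpa using hc
      -- By parity of lengths the cut lies between blocks of `thueMap v'`, so the roles of `v` and
      -- `v'` are exchanged.
      rcases thueMap_eq_append k₂ with ⟨v₃, v₄, rfl, h₃, h₄⟩ | ⟨v₃, c, v₄, -, h₃, -⟩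
      · obtain rfl := thueMap_injective h₄
        obtain ⟨rfl, h₅, h₆⟩ := eq_replicate_of_thueMap_append (v₁ := v₃) (v₂ := v₁)
          (v := v₁ ++ b' :: v₂) (b := b') (b' := b) (by rw [← h₃]; simp)
        exact ⟨rfl, v₃.length, v₁, Or.inr ⟨by rw [← h₅], h₆⟩⟩
      · have := congrArg List.length h₃
        simp at this
        omega

/-- A word `v` and a letter `b` such that the cyclic word of `thueMap v ++ [b]` is that of a
factor of the Thue–Morse word, and such that no other pair with the latter property arises by
moving a prefix of `thueMap v` to the end. -/
def IsTerminal (n : ℕ) (v : List (Fin 2)) (b : Fin 2) : Prop :=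
  (v ++ [b] ∈ wordFactors thueMorse (n + 1) ∨ (b + 1) :: v ∈ wordFactors thueMorse (n + 1)) ∧
    (v.head? = some b ∨ ∃ z, v = (b + 1) :: z ∧ (b + 1) :: v ∈ wordFactors thueMorse (n + 1) ∧
      z ++ [b] ∉ wordFactors thueMorse n)

/-- Moving one letter leads to a word containing the excluded `z ++ [b]`; moving two or more
requires the cube of `b + 1` in the factor `(b + 1) :: v`. -/
theorem IsTerminal.eq_zero {n i : ℕ} {b : Fin 2} {z : List (Fin 2)}
    (h : IsTerminal n (List.replicate i (b + 1) ++ z) b)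
    (h' : IsTerminal n (z ++ List.replicate i b) b) : i = 0 := by
  match i, h, h' with
  | 0, _, _ => rfl
  | 1, h, h' =>
    rcases h.2 with h₁ | ⟨y, hy, -, hn⟩
    · simp at h₁
    · obtain rfl : z = y := by simpa using hy
      rcases h'.1 with h₂ | h₂
      · exact absurd (mem_wordFactors_of_concat h₂) hn
      · exact absurd (mem_wordFactors_of_cons h₂) hn
  | i + 2, h, _ =>
    rcases h.2 with h₁ | ⟨y, -, h₂, -⟩
    · simp [List.replicate_succ] at h₁
    · have := length_le_two_of_const (p := []) (w := [b + 1, b + 1, b + 1])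
        (s := List.replicate i (b + 1) ++ z) (c := b + 1)
        (by simpa [List.replicate_succ] using h₂) (by simp)
      simp at this

theorem IsTerminal.eq_of_isRotated {n : ℕ} {v v' : List (Fin 2)} {b b' : Fin 2}
    (h : IsTerminal n v b) (h' : IsTerminal n v' b')
    (hr : thueMap v ++ [b] ~r thueMap v' ++ [b']) : v = v' ∧ b = b' := by
  obtain ⟨rfl, i, z, ⟨rfl, rfl⟩ | ⟨rfl, rfl⟩⟩ := exists_replicate_of_isRotated hr
  · obtain rfl := h.eq_zero h'
    simp
  · obtain rfl := h'.eq_zero h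
    simp

/-- The words of length `n` all of whose one-letter extensions to the right are factors. -/
def rightSpecial (n : ℕ) : Set (List (Fin 2)) :=
  {z | z ++ [0] ∈ wordFactors thueMorse (n + 1) ∧ z ++ [1] ∈ wordFactors thueMorse (n + 1)}

theorem rightSpecial_finite (n : ℕ) : (rightSpecial n).Finite :=
  (wordFactors_finite thueMorse n).subset fun _ h => mem_wordFactors_of_concat h.1

theorem ncard_wordFactors_succ (n : ℕ) : (wordFactors thueMorse (n + 1)).ncard =
    (wordFactors thueMorse n).ncard + (rightSpecial n).ncard := by
  let A (b : Fin 2) : Set (List (Fin 2)) := {z | z ++ [b] ∈ wordFactors thueMorse (n + 1)}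
  have hA (b : Fin 2) : (A b).Finite :=
    (wordFactors_finite thueMorse n).subset fun _ h => mem_wordFactors_of_concat h
  have h₁ : wordFactors thueMorse n = A 0 ∪ A 1 := by
    ext z
    constructor
    · rintro ⟨i, rfl⟩
      have hi : wordBlock thueMorse i n ++ [thueMorse (i + n)] ∈ wordFactors thueMorse (n + 1) :=
        ⟨i, wordBlock_succ' _ _ _⟩
      generalize thueMorse (i + n) = b at hi
      fin_cases b
      exacts [Or.inl hi, Or.inr hi]
    · rintro (h | h) <;> exact mem_wordFactors_of_concat h
  have h₂ : wordFactors thueMorse (n + 1) = (· ++ [0]) '' A 0 ∪ (· ++ [1]) '' A 1 := by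
    ext w
    constructor
    · intro hw
      obtain ⟨z, b, rfl⟩ := exists_eq_concat (w := w) (by rw [length_of_mem_wordFactors hw]; omega)
      fin_cases b
      exacts [Or.inl ⟨z, hw, rfl⟩, Or.inr ⟨z, hw, rfl⟩]
    · rintro (⟨z, h, rfl⟩ | ⟨z, h, rfl⟩) <;> exact h
  rw [h₂, ncard_image_union_image (hA 0) (hA 1) (List.append_left_injective _).injOn
    (List.append_left_injective _).injOn (fun a _ b _ h => by simpa using List.append_inj' h rfl),
    h₁, ← Set.ncard_union_add_ncard_inter _ _ (hA 0) (hA 1)]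
  rfl

/-- A discarded word `a c z a` is determined by `z` in `rightSpecial n` and the four choices of `(a,
c)`. -/
theorem equalEndsCount_le_ncard_notMem_rightSpecial (n : ℕ) :
    equalEndsCount (n + 3) ≤ {w | w ∈ wordFactors thueMorse (n + 3) ∧
      (EqualEnds w ∧ w.tail.tail.dropLast ∉ rightSpecial n)}.ncard +
        4 * (rightSpecial n).ncard := by
  let f : (Fin 2 × Fin 2) × List (Fin 2) → List (Fin 2) :=
    fun p => p.1.1 :: p.1.2 :: (p.2 ++ [p.1.1])
  have hfin : ((Set.univ : Set (Fin 2 × Fin 2)) ×ˢ rightSpecial n).Finite :=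
    Set.finite_univ.prod (rightSpecial_finite n)
  have hcard : ((Set.univ : Set (Fin 2 × Fin 2)) ×ˢ rightSpecial n).ncard =
      4 * (rightSpecial n).ncard := by
    rw [Set.ncard_prod, Set.ncard_univ]
    simp
  rw [← hcard]
  refine le_trans ?_ (Nat.add_le_add_left (Set.ncard_image_le (f := f) hfin) _)
  refine le_trans ?_ (Set.ncard_union_le _ _)
  refine Set.ncard_le_ncard ?_ ((finite_setOf_mem_wordFactors_and _ _).union (hfin.image f))
  rintro w ⟨hw, he⟩
  by_cases hr : w.tail.tail.dropLast ∈ rightSpecial n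
  · right
    have hl := length_of_mem_wordFactors hw
    obtain ⟨a, v, b, rfl⟩ := exists_eq_cons_concat (w := w) (by omega)
    obtain rfl := equalEnds_cons_concat.1 he
    cases v with
    | nil => simp at hl
    | cons c z => exact ⟨((a, c), z), ⟨trivial, by simpa using hr⟩, rfl⟩
  · exact Or.inl ⟨hw, he, hr⟩

theorem isTerminal_of_concat {n : ℕ} {w : List (Fin 2)} (hn : 1 ≤ n)
    (h : w ∈ wordFactors thueMorse (n + 1) ∧ EqualEnds w) :
    ∃ v b, w = v ++ [b] ∧ IsTerminal n v b := by
  obtain ⟨a, v, b, rfl⟩ :=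
    exists_eq_cons_concat (w := w) (by rw [length_of_mem_wordFactors h.1]; omega)
  obtain rfl := equalEnds_cons_concat.1 h.2
  exact ⟨a :: v, a, rfl, Or.inl h.1, Or.inl rfl⟩

/-- Write `v = c z`. As `z` is not right special, the last letter `b + 1` of `w` is its only
extension, so `z b` is not a factor. This blocks any move and also keeps `v b` from being a factor,
which separates this family from that of `isTerminal_of_concat`. -/
theorem isTerminal_of_cons_concat {n : ℕ} {w : List (Fin 2)}
    (hw : w ∈ wordFactors thueMorse (n + 3))
    (h : EqualEnds w ∧ w.tail.tail.dropLast ∉ rightSpecial n) :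
    ∃ v b, w = (b + 1) :: (v ++ [b + 1]) ∧ IsTerminal (n + 1) v b ∧
      v ++ [b] ∉ wordFactors thueMorse (n + 2) := by
  have hl := length_of_mem_wordFactors hw
  obtain ⟨a, v, b, rfl⟩ := exists_eq_cons_concat (w := w) (by omega)
  obtain rfl := equalEnds_cons_concat.1 h.1
  cases v with
  | nil => simp at hl
  | cons c z =>
    obtain ⟨b, rfl⟩ : ∃ b, a = b + 1 := ⟨a + 1, by simp⟩
    have h₁ : (b + 1) :: c :: z ∈ wordFactors thueMorse (n + 2) :=
      mem_wordFactors_of_concat (a := b + 1) (by simpa using hw)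
    have h₂ : z ++ [b + 1] ∈ wordFactors thueMorse (n + 1) :=
      mem_wordFactors_of_cons (mem_wordFactors_of_cons (by simpa using hw))
    have h₃ : z ++ [b] ∉ wordFactors thueMorse (n + 1) := by
      intro h₃
      apply h.2
      simp only [List.tail_cons, List.cons_append, List.dropLast_concat]
      revert h₂ h₃
      fin_cases b
      · exact fun h₂ h₃ => ⟨h₃, h₂⟩
      · exact fun h₂ h₃ => ⟨h₂, h₃⟩
    refine ⟨c :: z, b, rfl, ⟨Or.inr h₁, ?_⟩, fun h₄ => h₃ (mem_wordFactors_of_cons h₄)⟩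
    rcases eq_or_ne c b with rfl | hc
    · exact Or.inl rfl
    · obtain rfl := fin_two_ne_iff.1 hc
      exact Or.inr ⟨z, rfl, h₁, h₃⟩

theorem distinctEndsCount_le_cyclicComplexity_of_odd {n : ℕ} (hn : 1 ≤ n) :
    distinctEndsCount (2 * (n + 2)) ≤
      cyclicComplexity thueMorse (2 * (n + 1) + 1) + 4 * (rightSpecial n).ncard := by
  have h₁ := equalEndsCount_le_ncard_notMem_rightSpecial n
  rw [distinctEndsCount_two_mul (by omega)]
  suffices h : equalEndsCount (n + 2) + {w | w ∈ wordFactors thueMorse (n + 3) ∧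
      (EqualEnds w ∧ w.tail.tail.dropLast ∉ rightSpecial n)}.ncard ≤
        cyclicComplexity thueMorse (2 * (n + 1) + 1) by
    rw [show n + 2 + 1 = n + 3 from rfl]
    omega
  have key₁ {w : List (Fin 2)} (hw : w ∈ wordFactors thueMorse (n + 2) ∧ EqualEnds w) :=
    isTerminal_of_concat (n := n + 1) (by omega) hw
  have key₂ {v : List (Fin 2)} {b : Fin 2} :
      (thueMap ((b + 1) :: (v ++ [b + 1])).dropLast).tail ~r thueMap v ++ [b] := by
    have : (b + 1) :: (v ++ [b + 1]) = ((b + 1) :: v) ++ [b + 1] := rfl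
    rw [this, List.dropLast_concat, thueMap_cons, List.tail_cons, fin_two_add_one_add_one]
    exact List.isRotated_append (l := [b]) (l' := thueMap v)
  rw [equalEndsCount, ← ncard_image_union_image
    (f := fun w : List (Fin 2) => ((thueMap w).dropLast : Cycle (Fin 2)))
    (g := fun w : List (Fin 2) => ((thueMap w.dropLast).tail : Cycle (Fin 2)))
    (finite_setOf_mem_wordFactors_and _ _) (finite_setOf_mem_wordFactors_and _ _)]
  · refine Set.ncard_le_ncard ?_ (cyclicFactors_finite _ _)
    rintro _ (⟨w, ⟨hw, -⟩, rfl⟩ | ⟨w, ⟨hw, -⟩, rfl⟩)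
    · exact ⟨_, wordFactors_two_mul_add_one ▸ Or.inl ⟨w, hw, rfl⟩, rfl⟩
    · refine ⟨_, wordFactors_two_mul_add_one ▸ Or.inr ⟨w.dropLast, ?_, rfl⟩, rfl⟩
      obtain ⟨v, b, rfl⟩ :=
        exists_eq_concat (w := w) (by rw [length_of_mem_wordFactors hw]; omega)
      rw [List.dropLast_concat]
      exact mem_wordFactors_of_concat hw
  · intro w hw w' hw' h
    obtain ⟨v, b, rfl, ht⟩ := key₁ hw
    obtain ⟨v', b', rfl, ht'⟩ := key₁ hw'
    simp only [dropLast_thueMap_concat] at h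
    obtain ⟨rfl, rfl⟩ := ht.eq_of_isRotated ht' (Cycle.coe_eq_coe.1 h)
    rfl
  · rintro w ⟨hw, he⟩ w' ⟨hw', he'⟩ h
    obtain ⟨v, b, rfl, ht, -⟩ := isTerminal_of_cons_concat hw he
    obtain ⟨v', b', rfl, ht', -⟩ := isTerminal_of_cons_concat hw' he'
    obtain ⟨rfl, rfl⟩ :=
      ht.eq_of_isRotated ht' (key₂.symm.trans ((Cycle.coe_eq_coe.1 h).trans key₂))
    rfl
  · rintro w hw w' ⟨hw', he'⟩ h
    obtain ⟨v, b, rfl, ht⟩ := key₁ hw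
    obtain ⟨v', b', rfl, ht', hn⟩ := isTerminal_of_cons_concat hw' he'
    simp only [dropLast_thueMap_concat] at h
    obtain ⟨rfl, rfl⟩ := ht.eq_of_isRotated ht' ((Cycle.coe_eq_coe.1 h).trans key₂)
    exact hn hw.1

/-! ### Asymptotics -/

theorem exists_distinctEndsCount_le_cyclicComplexity :
    ∃ C, ∀ n, distinctEndsCount (n + 1) ≤ cyclicComplexity thueMorse n + C := by
  obtain ⟨C, hC⟩ := exists_ncard_wordFactors_succ_le
  refine ⟨4 * C + ∑ i ∈ Finset.range 9, distinctEndsCount i, fun n => ?_⟩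
  induction n using Nat.strong_induction_on with
  | _ n ih =>
    -- The doubling formula needs half-length at least 4; smaller `n` are absorbed by the sum in the
    -- constant.
    rcases Nat.lt_or_ge n 8 with hn | hn
    · have := Finset.single_le_sum (f := distinctEndsCount) (fun _ _ => Nat.zero_le _)
        (Finset.mem_range.2 (show n + 1 < 9 by omega))
      omega
    obtain ⟨m, rfl | rfl⟩ := Nat.even_or_odd' n
    · have := ih m (by omega)
      rw [distinctEndsCount_two_mul_add_one (by omega), cyclicComplexity_two_mul (by omega)]
      omega
    · obtain ⟨k, rfl⟩ := Nat.exists_eq_add_of_le' (show 1 ≤ m by omega)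
      have h₁ := distinctEndsCount_le_cyclicComplexity_of_odd (n := k) (by omega)
      have h₂ := hC k (by omega)
      rw [ncard_wordFactors_succ] at h₂
      rw [show 2 * (k + 1) + 1 + 1 = 2 * (k + 2) by ring]
      omega

theorem exists_le_cyclicComplexity :
    ∃ C : ℕ, ∀ n, 1 ≤ n → 4 * n ≤ 3 * cyclicComplexity thueMorse n + C := by
  obtain ⟨C, hC⟩ := exists_distinctEndsCount_le_cyclicComplexity
  refine ⟨3 * C, fun n hn => ?_⟩
  have := (endsCount_bounds n hn).2.2
  have := hC n
  omega

theorem distinctEndsCount_six_mul_two_pow (j : ℕ) :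
    distinctEndsCount (6 * 2 ^ j + 1) = 8 * 2 ^ j := by
  induction j with
  | zero =>
    rw [show 6 * 2 ^ 0 + 1 = 2 * 3 + 1 by rfl, distinctEndsCount_two_mul_add_one (by omega),
      show 3 + 1 = 2 * 2 by rfl, distinctEndsCount_two_mul le_rfl, equalEndsCount_two,
      equalEndsCount_three]
    rfl
  | succ j ih =>
    have := Nat.one_le_two_pow (n := j)
    rw [show 6 * 2 ^ (j + 1) + 1 = 2 * (6 * 2 ^ j) + 1 by ring,
      distinctEndsCount_two_mul_add_one (by omega), ih]
    ring

/-- The increments `8 * 2 ^ j` form a geometric sum. Lengths start at 6, since doubling is available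
only from length 4 on. -/
theorem cyclicComplexity_six_mul_two_pow_le (j : ℕ) :
    cyclicComplexity thueMorse (6 * 2 ^ j) ≤ 8 * 2 ^ j + cyclicComplexity thueMorse 6 := by
  induction j with
  | zero => simp
  | succ j ih =>
    have := Nat.one_le_two_pow (n := j)
    rw [show 6 * 2 ^ (j + 1) = 2 * (6 * 2 ^ j) by ring, cyclicComplexity_two_mul (by omega),
      distinctEndsCount_six_mul_two_pow, pow_succ]
    omega

open Filter Topology in
theorem corollary7 :
    Filter.liminf (fun n : ℕ => (((cyclicComplexity thueMorse n : ℝ) / (n : ℝ) : ℝ) : EReal))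
      Filter.atTop = ((4 / 3 : ℝ) : EReal) := by
  obtain ⟨C, hC⟩ := exists_le_cyclicComplexity
  have hlim (a c : ℝ) : Tendsto (fun n : ℕ => ((a + c / n : ℝ) : EReal)) atTop (𝓝 (a : EReal)) := by
    refine (continuous_coe_real_ereal.tendsto a).comp ?_
    simpa using tendsto_const_nhds.add (tendsto_const_div_atTop_nhds_zero_nat c)
  refine le_antisymm ?_ ?_
  · have hφ : Tendsto (fun j : ℕ => 6 * 2 ^ j) atTop atTop :=
      (tendsto_pow_atTop_atTop_of_one_lt one_lt_two).const_mul_atTop' (by norm_num)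
    -- Here `8 * 2 ^ j / (6 * 2 ^ j) = 4 / 3`, and the additive constant vanishes in the limit along
    -- this subsequence.
    rw [← ((hlim (4 / 3) (cyclicComplexity thueMorse 6)).comp hφ).liminf_eq]
    refine (liminf_le_liminf_of_le hφ).trans ?_
    change liminf (fun j : ℕ => (((cyclicComplexity thueMorse (6 * 2 ^ j) : ℝ) /
      ((6 * 2 ^ j : ℕ) : ℝ) : ℝ) : EReal)) atTop ≤ _
    refine liminf_le_liminf (Eventually.of_forall fun j => ?_)
    simp only [Function.comp_apply, EReal.coe_le_coe_iff]
    have h : (cyclicComplexity thueMorse (6 * 2 ^ j) : ℝ) ≤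
        8 * 2 ^ j + cyclicComplexity thueMorse 6 := by
      exact_mod_cast cyclicComplexity_six_mul_two_pow_le j
    have h2 : (0 : ℝ) < 2 ^ j := by positivity
    push_cast
    rw [div_le_iff₀ (by positivity), add_mul, div_mul_cancel₀ _ (by positivity)]
    linarith
  · rw [← (hlim (4 / 3) (-(C / 3))).liminf_eq]
    refine liminf_le_liminf ?_
    filter_upwards [eventually_ge_atTop 1] with n hn
    rw [EReal.coe_le_coe_iff]
    have h : (4 : ℝ) * n ≤ 3 * cyclicComplexity thueMorse n + C := by exact_mod_cast hC n hn
    have hn' : (0 : ℝ) < n := by exact_mod_cast hn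
    rw [le_div_iff₀ hn', add_mul, div_mul_cancel₀ _ hn'.ne']
    linarith
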